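/- Let $\Omega\subset\mathbb{R}^3$ be a bounded, contractible Lipschitz domain, and let $(\cdot,\cdot)$ and $\|\cdot\|$ be the $L^2(\Omega)$ inner product and norm. Let $H_0^1$, $H_0(\mathrm{curl})$, $H_0(\mathrm{div})$ be the usual subspaces of $H^1(\Omega)$, $H(\mathrm{curl};\Omega)$, $H(\mathrm{div};\Omega)$ of fields with vanishing trace, tangential trace and normal trace on $\partial\Omega$ respectively, and let $L^2_0$ be the space of $L^2(\Omega)$ functions with zero mean. There is a constant $C>0$ depending only on $\Omega$ such that the following holds. Let $$0\to H_0^{1,h}\xrightarrow{\ \mathrm{grad}\ }H_0^h(\mathrm{curl})\xrightarrow{\ \mathrm{curl}\ }H_0^h(\mathrm{div})\xrightarrow{\ \mathrm{div}\ }L_0^{2,h}\to 0$$ be an exact finite element subcomplex of $0\to H_0^1\to H_0(\mathrm{curl})\to H_0(\mathrm{div})\to L_0^2\to 0$ (more generally, any exact subcomplex of finite-dimensional subspaces such that the fields in $H_0^h(\mathrm{curl})$ are essentially bounded). Let $\tau>0$ and $B_0\in H_0^h(\mathrm{div})$, and let $B_h\in C^1([0,\infty);H_0^h(\mathrm{div}))$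 with $B_h|_{t=0}=B_0$ and $E_h,j_h,H_h\in C^0([0,\infty);H_0^h(\mathrm{curl}))$ satisfy $$\begin{aligned} (\partial_t B_h,C_h)+(\mathrm{curl}\,E_h,C_h)&=0,\\ (E_h,F_h)+\tau((j_h\times H_h)\times H_h,F_h)&=0,\\ (j_h,K_h)&=(B_h,\mathrm{curl}\,K_h),\\ (H_h,D_h)&=(B_h,D_h) \end{aligned}$$ for all $t\ge 0$ and all $(C_h,F_h,K_h,D_h)\in H_0^h(\mathrm{div})\times H_0^h(\mathrm{curl})^3$. Then for all $t\ge0$: 1. $\partial_tB_h+\mathrm{curl}\,E_h=0$; 2. $\mathrm{div}\,B_h=\mathrm{div}\,B_0$; in particular, if $\mathrm{div}\,B_0=0$, then $\mathrm{div}\,B_h=0$; 3. the energy $\mathcal{E}_h:=\|B_h\|^2$ satisfies $\mathcal{E}_h(t)-\mathcal{E}_h(0)=-2\tau\int_0^t\|j_h\times H_h\|^2\,ds\le 0$. If moreover $\mathrm{div}\,B_0=0$, then for every $t\ge 0$ there exists $A_h\in H_0^h(\mathrm{curl})$ with $\mathrm{curl}\,A_h=B_h(t)$, the helicity $\mathcal{H}_h(t):=(A_h,B_h(t))$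 does not depend on the choice of such an $A_h$, and 4. $\mathcal{H}_h(t)-\mathcal{H}_h(0)=0$; 5. $C\,|\mathcal{H}_h(t)|\le\mathcal{E}_h(t)$. -/

import Mathlib

noncomputable section

namespace MagnetoFriction

open MeasureTheory Set
open scoped ContDiff RealInnerProductSpace

/-- Euclidean three-space. -/
abbrev R3 := EuclideanSpace ℝ (Fin 3)

/-- Scalar `L²(Ω)`. -/
abbrev L2S (Ω : Set R3) := Lp ℝ 2 (volume.restrict Ω)

/-- Vector-valued `L²(Ω)`. -/
abbrev L2V (Ω : Set R3) := Lp R3 2 (volume.restrict Ω)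

/-! ### Domains -/

/-- `Ω` is a bounded Lipschitz domain: open, connected, bounded, and near each boundary point, in
suitable Cartesian coordinates, the set of points above the graph of a Lipschitz function. -/
structure IsBoundedLipschitzDomain (Ω : Set R3) : Prop where
  isOpen : IsOpen Ω
  isConnected : IsConnected Ω
  isBounded : Bornology.IsBounded Ω
  lipschitz_boundary : ∀ p ∈ frontier Ω,
    ∃ (e : R3 ≃ᵃⁱ[ℝ] R3) (g : EuclideanSpace ℝ (Fin 2) → ℝ) (K : NNReal) (U : Set R3),
      LipschitzWith K g ∧ IsOpen U ∧ p ∈ U ∧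
        ∀ x ∈ U, x ∈ Ω ↔ g !₂[e x 0, e x 1] < e x 2

/-! ### Classical vector calculus -/

/-- The vector (cross) product on `ℝ³`. -/
def cross (a b : R3) : R3 := WithLp.toLp 2 (crossProduct a.ofLp b.ofLp)

/-- The partial derivative `∂ᵢ φₖ`. -/
def pd (φ : R3 → R3) (i k : Fin 3) (x : R3) : ℝ :=
  (fderiv ℝ φ x (EuclideanSpace.single i 1)) k

/-- The classical curl. -/
def cCurl (φ : R3 → R3) (x : R3) : R3 :=
  !₂[pd φ 1 2 x - pd φ 2 1 x, pd φ 2 0 x - pd φ 0 2 x, pd φ 0 1 x - pd φ 1 0 x]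

/-- The classical divergence. -/
def cDiv (φ : R3 → R3) (x : R3) : ℝ := ∑ i, pd φ i i x

/-- `φ ∈ C_c^∞(ℝ³; F)`. -/
def IsSmoothCpt {F : Type*} [NormedAddCommGroup F] [NormedSpace ℝ F] (φ : R3 → F) : Prop :=
  ContDiff ℝ ∞ φ ∧ HasCompactSupport φ

/-- `φ ∈ C_c^∞(Ω; F)`. -/
def IsTest {F : Type*} [NormedAddCommGroup F] [NormedSpace ℝ F] (Ω : Set R3) (φ : R3 → F) :
    Prop :=
  IsSmoothCpt φ ∧ tsupport φ ⊆ Ω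

/-! ### Weak differential operators on `Ω` -/

/-- `g` is the weak gradient of `u` in `Ω`. -/
def HasWeakGrad (Ω : Set R3) (u : L2S Ω) (g : L2V Ω) : Prop :=
  ∀ φ : R3 → R3, IsTest Ω φ → ∫ x in Ω, ⟪g x, φ x⟫ = - ∫ x in Ω, u x * cDiv φ x

/-- `w` is the weak curl of `v` in `Ω`. -/
def HasWeakCurl (Ω : Set R3) (v w : L2V Ω) : Prop :=
  ∀ φ : R3 → R3, IsTest Ω φ → ∫ x in Ω, ⟪w x, φ x⟫ = ∫ x in Ω, ⟪v x, cCurl φ x⟫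

/-- `d` is the weak divergence of `v` in `Ω`. -/
def HasWeakDiv (Ω : Set R3) (v : L2V Ω) (d : L2S Ω) : Prop :=
  ∀ φ : R3 → ℝ, IsTest Ω φ → ∫ x in Ω, d x * φ x = - ∫ x in Ω, ⟪v x, gradient φ x⟫

/-- `u ∈ H¹(Ω)`. -/
def MemH1 (Ω : Set R3) (u : L2S Ω) : Prop := ∃ g, HasWeakGrad Ω u g

/-- `v ∈ H(curl, Ω)`. -/
def MemHCurl (Ω : Set R3) (v : L2V Ω) : Prop := ∃ w, HasWeakCurl Ω v w

/-- `v ∈ H(div, Ω)`. -/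
def MemHDiv (Ω : Set R3) (v : L2V Ω) : Prop := ∃ d, HasWeakDiv Ω v d

open Classical in
/-- The weak gradient of a member of `H¹(Ω)`; the value is zero elsewhere. -/
def wGrad (Ω : Set R3) (u : L2S Ω) : L2V Ω := if h : MemH1 Ω u then h.choose else 0

open Classical in
/-- The weak curl of a member of `H(curl, Ω)`; the value is zero elsewhere. -/
def wCurl (Ω : Set R3) (v : L2V Ω) : L2V Ω := if h : MemHCurl Ω v then h.choose else 0

open Classical in
/-- The weak divergence of a member of `H(div, Ω)`; the value is zero elsewhere. -/
def wDiv (Ω : Set R3) (v : L2V Ω) : L2S Ω := if h : MemHDiv Ω v then h.choose else 0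

/-! ### Boundary traces and the spaces with homogeneous boundary conditions

The traces are the usual ones defined by Green's formulas: functionals of the boundary values of
smooth fields. -/

/-- The trace of `u ∈ H¹(Ω)`, acting on smooth fields: `φ ↦ ∫_{∂Ω} u φ·n`. -/
def trace (Ω : Set R3) (u : L2S Ω) (φ : R3 → R3) : ℝ :=
  (∫ x in Ω, ⟪wGrad Ω u x, φ x⟫) + ∫ x in Ω, u x * cDiv φ x

/-- The tangential trace of `v ∈ H(curl, Ω)`, acting on smooth fields:
`φ ↦ ∫_{∂Ω} (n × v)·φ`. -/
def tangentialTrace (Ω : Set R3) (v : L2V Ω) (φ : R3 → R3) : ℝ :=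
  (∫ x in Ω, ⟪wCurl Ω v x, φ x⟫) - ∫ x in Ω, ⟪v x, cCurl φ x⟫

/-- The normal trace of `v ∈ H(div, Ω)`, acting on smooth functions: `φ ↦ ∫_{∂Ω} (v·n) φ`. -/
def normalTrace (Ω : Set R3) (v : L2V Ω) (φ : R3 → ℝ) : ℝ :=
  (∫ x in Ω, wDiv Ω v x * φ x) + ∫ x in Ω, ⟪v x, gradient φ x⟫

/-- `u ∈ H₀¹(Ω)`. -/
def MemH10 (Ω : Set R3) (u : L2S Ω) : Prop :=
  MemH1 Ω u ∧ ∀ φ : R3 → R3, IsSmoothCpt φ → trace Ω u φ = 0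

/-- `v ∈ H₀(curl, Ω)`. -/
def MemH0Curl (Ω : Set R3) (v : L2V Ω) : Prop :=
  MemHCurl Ω v ∧ ∀ φ : R3 → R3, IsSmoothCpt φ → tangentialTrace Ω v φ = 0

/-- `v ∈ H₀(div, Ω)`. -/
def MemH0Div (Ω : Set R3) (v : L2V Ω) : Prop :=
  MemHDiv Ω v ∧ ∀ φ : R3 → ℝ, IsSmoothCpt φ → normalTrace Ω v φ = 0

/-- `q ∈ L₀²(Ω)`. -/
def MemL20 (Ω : Set R3) (q : L2S Ω) : Prop := ∫ x in Ω, q x = 0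

/-! ### Discrete de Rham complexes -/

/-- A finite-dimensional subcomplex
`0 → V0 → V1 → V2 → V3 → 0` of `0 → H₀¹ → H₀(curl) → H₀(div) → L₀² → 0`.
Of the finite element structure only the finite dimension and the essential boundedness of the
members of `V1` (which holds for piecewise polynomials, and makes the products of the scheme
integrable) are retained. -/
structure DiscreteComplex (Ω : Set R3) where
  V0 : Submodule ℝ (L2S Ω)
  V1 : Submodule ℝ (L2V Ω)
  V2 : Submodule ℝ (L2V Ω)
  V3 : Submodule ℝ (L2S Ω)
  finite0 : FiniteDimensional ℝ V0
  finite1 : FiniteDimensional ℝ V1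
  finite2 : FiniteDimensional ℝ V2
  finite3 : FiniteDimensional ℝ V3
  mem0 : ∀ u ∈ V0, MemH10 Ω u
  mem1 : ∀ v ∈ V1, MemH0Curl Ω v
  mem2 : ∀ v ∈ V2, MemH0Div Ω v
  mem3 : ∀ q ∈ V3, MemL20 Ω q
  bounded1 : ∀ v ∈ V1, MemLp v ⊤ (volume.restrict Ω)
  grad_mem : ∀ u ∈ V0, wGrad Ω u ∈ V1
  curl_mem : ∀ v ∈ V1, wCurl Ω v ∈ V2
  div_mem : ∀ v ∈ V2, wDiv Ω v ∈ V3

/-- Exactness of the discrete complex. (That it is a complex is part of the equivalences.) -/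
structure DiscreteComplex.IsExact {Ω : Set R3} (X : DiscreteComplex Ω) : Prop where
  exact0 : ∀ u ∈ X.V0, wGrad Ω u = 0 → u = 0
  exact1 : ∀ v ∈ X.V1, wCurl Ω v = 0 ↔ ∃ u ∈ X.V0, wGrad Ω u = v
  exact2 : ∀ v ∈ X.V2, wDiv Ω v = 0 ↔ ∃ w ∈ X.V1, wCurl Ω w = v
  exact3 : ∀ q ∈ X.V3, ∃ v ∈ X.V2, wDiv Ω v = q

/-! ### The semi-discrete scheme -/

/-- `∂ₜ B` on `[0, ∞)`, one-sided at `t = 0`. -/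
def timeDeriv {Ω : Set R3} {X : DiscreteComplex Ω} (B : ℝ → X.V2) (t : ℝ) : X.V2 :=
  derivWithin B (Ici 0) t

/-- `(B, E, j, H)` solves the semi-discrete magneto-frictional scheme on `[0, ∞)` with coupling
parameter `τ` and initial datum `B₀`. Values at negative times play no role. -/
structure IsSolution {Ω : Set R3} (X : DiscreteComplex Ω) (τ : ℝ) (B₀ : X.V2)
    (B : ℝ → X.V2) (E j H : ℝ → X.V1) : Prop where
  contDiffOn_B : ContDiffOn ℝ 1 B (Ici 0)
  continuousOn_E : ContinuousOn E (Ici 0)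
  continuousOn_j : ContinuousOn j (Ici 0)
  continuousOn_H : ContinuousOn H (Ici 0)
  initial : B 0 = B₀
  advection : ∀ t, 0 ≤ t → ∀ C ∈ X.V2,
    ⟪(timeDeriv B t : L2V Ω), C⟫ + ⟪wCurl Ω (E t), C⟫ = 0
  electric : ∀ t, 0 ≤ t → ∀ F ∈ X.V1,
    ⟪(E t : L2V Ω), F⟫ + τ * ∫ x in Ω,
      ⟪cross (cross ((j t : L2V Ω) x) ((H t : L2V Ω) x)) ((H t : L2V Ω) x), F x⟫ = 0
  current : ∀ t, 0 ≤ t → ∀ K ∈ X.V1,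
    ⟪(j t : L2V Ω), K⟫ = ⟪(B t : L2V Ω), wCurl Ω K⟫
  magnetic : ∀ t, 0 ≤ t → ∀ D ∈ X.V1,
    ⟪(H t : L2V Ω), D⟫ = ⟪(B t : L2V Ω), D⟫

/-- `‖v × w‖²`, the squared `L²(Ω)` norm of the cross product. -/
def crossNormSq {Ω : Set R3} (v w : L2V Ω) : ℝ := ∫ x in Ω, ‖cross (v x) (w x)‖ ^ 2

/-- `A ∈ V1` is a discrete magnetic potential of `b`. -/
def IsPotential {Ω : Set R3} (X : DiscreteComplex Ω) (b A : L2V Ω) : Prop :=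
  A ∈ X.V1 ∧ wCurl Ω A = b

end MagnetoFriction

end

noncomputable section

namespace MagnetoFriction

open MeasureTheory Set Filter Topology Convolution
open scoped ContDiff RealInnerProductSpace

/-! The conservation laws come from testing the scheme with its own unknowns. The residual of the
advection equation lies in `X.V2`, so it vanishes, and the divergence is constant because div curl =
0. Testing the electric equation with `j` gives `(B, curl E) = τ‖j × H‖²`, hence energy decay;
testing it with `H` gives `(B, E) = 0`. Since the curl is symmetric on `H₀(curl)`, both terms in the
time derivative of `(A, B)` reduce to `(B, E)`, so helicity is conserved.

Two facts about `H₀(curl)` carry the analysis: `MemH0Curl.inner_wCurl_comm` (symmetry) and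
`exists_arnold`. Both are proved on the whole space: a zero tangential trace says exactly that
extension by zero commutes with the weak curl. Mollification then gives symmetry.

For Arnold's inequality, with `w = curl v`, slide `v` along `e₃` until its support leaves that of
`w`. The pairing `∫ w · v(· + s e₃)` goes from the helicity to zero, and its slope is at most
`‖w‖²`: `∂₃v` is `∇v₃`, orthogonal to the divergence-free `w`, plus `curl v × e₃`. So the helicity
is at most the sliding distance times `‖w‖²`, and the constant depends only on a ball containing
`Ω`. -/

/-! ### Square integrable fields of bounded support -/

/-- A square integrable field on `ℝ³` that vanishes outside the closed ball of radius `R`. -/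
structure IsL2Ball (R : ℝ) (v : R3 → R3) : Prop where
  memLp : MemLp v 2 volume
  eq_zero : ∀ x, R < ‖x‖ → v x = 0

theorem IsL2Ball.integrable {R : ℝ} {v : R3 → R3} (hv : IsL2Ball R v) : Integrable v := by
  have hsub : Function.support v ⊆ Metric.closedBall 0 R := by
    intro x hx
    by_contra h
    exact hx (hv.eq_zero x (by simpa using h))
  rw [← integrableOn_iff_integrable_of_support_subset hsub]
  have : IsFiniteMeasure (volume.restrict (Metric.closedBall (0 : R3) R)) :=
    ⟨by rw [Measure.restrict_apply_univ]; exact measure_closedBall_lt_top⟩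
  exact (hv.memLp.restrict _).integrable (by norm_num)

/-- The correlation `y ↦ ∫ a(x - y) · b(x) dx` of two fields. -/
def corr (a b : R3 → R3) (y : R3) : ℝ := ∫ x, ⟪a (x - y), b x⟫

theorem corr_zero (a b : R3 → R3) : corr a b 0 = ∫ x, ⟪a x, b x⟫ := by simp [corr]

/-- As an `L²` pairing with a translate, the correlation inherits continuity from the strong
continuity of translations, and a uniform bound from their being isometries. -/
theorem corr_eq_inner {a b : R3 → R3} (ha : MemLp a 2 volume) (hb : MemLp b 2 volume) (y : R3) :
    corr a b y = ⟪DomAddAct.mk (-y) +ᵥ ha.toLp a, hb.toLp b⟫ := by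
  rw [DomAddAct.mk_vadd_toLp, L2.inner_def]
  refine integral_congr_ae ?_
  have ha' : MemLp (fun x => a (-y +ᵥ x)) 2 volume :=
    ha.comp_measurePreserving (measurePreserving_vadd (-y) volume)
  filter_upwards [hb.coeFn_toLp, ha'.coeFn_toLp] with x h1 h2
  rw [h1, h2]
  simp [sub_eq_neg_add]

theorem continuous_corr {a b : R3 → R3} (ha : MemLp a 2 volume) (hb : MemLp b 2 volume) :
    Continuous (corr a b) := by
  have h2 : Fact ((2 : ENNReal) ≠ ⊤) := ⟨by norm_num⟩
  have h : corr a b = fun y : R3 => ⟪DomAddAct.mk (-y) +ᵥ ha.toLp a, hb.toLp b⟫ :=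
    funext fun y => corr_eq_inner ha hb y
  rw [h]
  have hc : Continuous fun y : R3 => DomAddAct.mk (-y) :=
    DomAddAct.continuous_mk.comp continuous_neg
  exact (hc.vadd continuous_const).inner continuous_const

theorem abs_corr_le {a b : R3 → R3} (ha : MemLp a 2 volume) (hb : MemLp b 2 volume) (y : R3) :
    |corr a b y| ≤ ‖ha.toLp a‖ * ‖hb.toLp b‖ := by
  rw [corr_eq_inner ha hb]
  refine (abs_real_inner_le_norm _ _).trans_eq ?_
  rw [DomAddAct.norm_vadd_Lp]

/-! ### Mollification -/

/-- The mollification `ρ ⋆ v`. -/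
abbrev mollify (ρ : R3 → ℝ) (v : R3 → R3) : R3 → R3 := ρ ⋆[ContinuousLinearMap.lsmul ℝ ℝ, volume] v

/-- Fubini: mollifying one factor of a pairing averages the correlation against `ρ`. Limits and
bounds for mollified pairings thus become statements about `corr`. -/
theorem integral_inner_mollify {ρ : R3 → ℝ} (hρ : Continuous ρ) (hρc : HasCompactSupport ρ)
    {a b : R3 → R3} (ha : Integrable a) (hb : Integrable b) (z : R3) :
    ∫ x, ⟪mollify ρ a (x - z), b x⟫ = ∫ y, ρ y * corr a b (y + z) := by
  have hint : Integrable (fun p : R3 × R3 => ρ p.1 * ⟪a (p.2 - (p.1 + z)), b p.2⟫)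
      (volume.prod volume) := by
    have ha' : Integrable (fun u => a (-u - z)) := (ha.comp_sub_right z).comp_neg
    have h := hb.convolution_integrand (innerSL ℝ) ha'
    obtain ⟨M, hM⟩ := hρc.exists_bound_of_continuous hρ
    refine (h.bdd_mul (f := fun p : R3 × R3 => ρ p.1) (c := M) ?_ ?_).congr ?_
    · exact (hρ.comp continuous_fst).aestronglyMeasurable
    · exact Eventually.of_forall fun p => hM p.1
    · refine Eventually.of_forall fun p => ?_
      have hx : -(p.1 - p.2) - z = p.2 - (p.1 + z) := by abel
      simp only [hx]
      rw [real_inner_comm]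
      rfl
  have hswap := integral_integral_swap
    (f := fun y x => ρ y * ⟪a (x - (y + z)), b x⟫) hint
  simp only [corr, ← integral_const_mul]
  rw [hswap]
  refine integral_congr_ae ?_
  refine Eventually.of_forall fun x => ?_
  have hi : Integrable fun t => ρ t • a (x - z - t) := by
    obtain ⟨M, hM⟩ := hρc.exists_bound_of_continuous hρ
    exact (ha.comp_sub_left (x - z)).bdd_smul M hρ.aestronglyMeasurable (Eventually.of_forall hM)
  have := integral_inner (𝕜 := ℝ) hi (b x)
  simp only [mollify, convolution_lsmul]
  rw [real_inner_comm, ← this]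
  refine integral_congr_ae (Eventually.of_forall fun t => ?_)
  simp only [inner_smul_right]
  rw [real_inner_comm]
  congr 3
  abel_nf

theorem isSmoothCpt_mollify {ρ : R3 → ℝ} (hρ : IsSmoothCpt ρ) {R : ℝ} {v : R3 → R3}
    (hv : IsL2Ball R v) : IsSmoothCpt (mollify ρ v) := by
  refine ⟨hρ.2.contDiff_convolution_left (n := ⊤) _ hρ.1 hv.integrable.locallyIntegrable, ?_⟩
  refine hρ.2.convolution _ ?_
  refine HasCompactSupport.intro (isCompact_closedBall (0 : R3) R) fun x hx => hv.eq_zero x ?_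
  simpa using hx

theorem mollify_eq_zero {ρ : R3 → ℝ} {r R : ℝ} {v : R3 → R3}
    (hρ : ∀ x, r < ‖x‖ → ρ x = 0) (hv : ∀ x, R < ‖x‖ → v x = 0) {x : R3} (hx : r + R < ‖x‖) :
    mollify ρ v x = 0 := by
  simp only [mollify, convolution_lsmul]
  rw [integral_eq_zero_of_ae]
  refine Eventually.of_forall fun t => ?_
  by_cases ht : r < ‖t‖
  · simp [hρ t ht]
  · have : ‖x‖ ≤ ‖t‖ + ‖x - t‖ := by simpa using norm_add_le t (x - t)
    simp [hv (x - t) (by linarith [not_lt.1 ht])]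

/-! ### Fields on the whole space with a weak curl -/

/-- `w` is the weak curl of `v` on `ℝ³`. -/
def HasGlobalCurl (v w : R3 → R3) : Prop :=
  ∀ φ : R3 → R3, IsSmoothCpt φ → ∫ x, ⟪w x, φ x⟫ = ∫ x, ⟪v x, cCurl φ x⟫

theorem inner_eq_sum (a b : R3) : ⟪a, b⟫ = a 0 * b 0 + a 1 * b 1 + a 2 * b 2 := by
  simp [PiLp.inner_apply, Fin.sum_univ_three, mul_comm]

theorem pd_mollify {ρ : R3 → ℝ} (hρ : IsSmoothCpt ρ) {v : R3 → R3} (hv : Integrable v)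
    (i k : Fin 3) (x : R3) :
    pd (mollify ρ v) i k x = ∫ t, fderiv ℝ ρ (x - t) (EuclideanSpace.single i 1) * v t k := by
  have h1 : ContDiff ℝ 1 ρ := hρ.1.of_le (by simp)
  have hd := hρ.2.hasFDerivAt_convolution_left (ContinuousLinearMap.lsmul ℝ ℝ) (μ := volume)
    h1 hv.locallyIntegrable x
  have hce : ConvolutionExistsAt (fderiv ℝ ρ) v x
      ((ContinuousLinearMap.lsmul ℝ ℝ : ℝ →L[ℝ] R3 →L[ℝ] R3).precompL R3) volume :=
    (hρ.2.fderiv ℝ).convolutionExists_left _ (h1.continuous_fderiv one_ne_zero)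
      hv.locallyIntegrable x
  have hce' := hce.integrable_swap
  have key : ∀ (A : R3 →L[ℝ] R3),
      ((EuclideanSpace.proj k : R3 →L[ℝ] ℝ).comp
        (ContinuousLinearMap.apply ℝ R3 (EuclideanSpace.single i (1 : ℝ)))) A
        = (A (EuclideanSpace.single i 1)) k := fun A => rfl
  rw [pd, hd.fderiv, ← key, convolution_eq_swap, ← ContinuousLinearMap.integral_comp_comm _ hce']
  refine integral_congr_ae (Eventually.of_forall fun t => ?_)
  simp [key]

theorem pd_smul_const {g : R3 → ℝ} {x : R3} (hg : DifferentiableAt ℝ g x) (c : R3) (i k : Fin 3) :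
    pd (fun t => g t • c) i k x = fderiv ℝ g x (EuclideanSpace.single i 1) * c k := by
  have := (hg.hasFDerivAt.smul_const c).fderiv
  rw [pd, this]
  simp

theorem integrable_fderiv_mul {ρ : R3 → ℝ} (hρ : IsSmoothCpt ρ) {v : R3 → R3} (hv : Integrable v)
    (i k : Fin 3) (x : R3) :
    Integrable fun t => fderiv ℝ ρ (x - t) (EuclideanSpace.single i 1) * v t k := by
  have h1 : ContDiff ℝ 1 ρ := hρ.1.of_le (by simp)
  have hcont : Continuous (fderiv ℝ ρ) := h1.continuous_fderiv one_ne_zero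
  obtain ⟨M, hM⟩ := (hρ.2.fderiv ℝ).exists_bound_of_continuous hcont
  have hvk : Integrable fun t => v t k :=
    (EuclideanSpace.proj k : R3 →L[ℝ] ℝ).integrable_comp hv
  refine hvk.bdd_mul (c := M) ?_ ?_
  · exact ((hcont.comp (continuous_const.sub continuous_id)).clm_apply
      continuous_const).aestronglyMeasurable
  · refine Eventually.of_forall fun t => ?_
    refine (ContinuousLinearMap.le_opNorm _ _).trans ?_
    simpa using hM (x - t)

/-- Testing the weak curl with `ρ(x - ·) c` for constant `c` evaluates `ρ ⋆ w` at `x`; the right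
side is then `∇ρ × v` integrated, which is the curl of `ρ ⋆ v` with the derivative on `ρ`. -/
theorem HasGlobalCurl.cCurl_mollify {ρ : R3 → ℝ} (hρ : IsSmoothCpt ρ) {R : ℝ} {v w : R3 → R3}
    (hv : IsL2Ball R v) (hw : IsL2Ball R w) (h : HasGlobalCurl v w) :
    cCurl (mollify ρ v) = mollify ρ w := by
  funext x
  have hsm : ContDiff ℝ ∞ fun t => ρ (x - t) := hρ.1.comp (contDiff_const.sub contDiff_id)
  have hcs : HasCompactSupport fun t => ρ (x - t) :=
    hρ.2.comp_homeomorph (Homeomorph.subLeft x)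
  have hfd : ∀ t u, fderiv ℝ (fun t => ρ (x - t)) t u = - fderiv ℝ ρ (x - t) u := by
    intro t u
    have h1 : HasFDerivAt (fun t => x - t) (-ContinuousLinearMap.id ℝ R3) t :=
      (hasFDerivAt_id t).const_sub x
    have h2 := ((hρ.1.differentiable (by simp)) (x - t)).hasFDerivAt.comp t h1
    have h3 := h2.fderiv
    rw [Function.comp_def] at h3
    rw [h3]
    simp
  have hpair : ∀ c : R3, ⟪mollify ρ w x, c⟫
      = ∫ t, ⟪v t, cCurl (fun t => ρ (x - t) • c) t⟫ := by
    intro c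
    have hφ : IsSmoothCpt (fun t => ρ (x - t) • c) := ⟨hsm.smul contDiff_const, hcs.smul_right⟩
    rw [← h _ hφ, mollify, convolution_eq_swap, real_inner_comm]
    have hi : Integrable fun t => ρ (x - t) • w t := by
      obtain ⟨M, hM⟩ := hρ.2.exists_bound_of_continuous hρ.1.continuous
      exact hw.integrable.bdd_smul M
        (hρ.1.continuous.comp (continuous_const.sub continuous_id)).aestronglyMeasurable
        (Eventually.of_forall fun t => hM (x - t))
    simp only [ContinuousLinearMap.lsmul_apply]
    rw [← integral_inner hi c]
    refine integral_congr_ae (Eventually.of_forall fun t => ?_)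
    simp [inner_smul_right, real_inner_comm]
  have hcurl : ∀ c t, ⟪v t, cCurl (fun t => ρ (x - t) • c) t⟫ =
      ⟪cross (WithLp.toLp 2 fun i => fderiv ℝ ρ (x - t) (EuclideanSpace.single i 1)) (v t), c⟫ := by
    intro c t
    have hd : DifferentiableAt ℝ (fun t => ρ (x - t)) t :=
      (hsm.differentiable (by simp)) t
    rw [inner_eq_sum, inner_eq_sum]
    simp only [cCurl, pd_smul_const hd, hfd, cross, cross_apply]
    simp
    ring
  have hi := fun i k => integrable_fderiv_mul hρ hv.integrable i k x
  have hcomp : ∀ (a : R3) k, ⟪a, EuclideanSpace.single k 1⟫ = a k := by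
    intro a k
    rw [real_inner_comm, EuclideanSpace.inner_single_left]
    simp
  ext k
  rw [← hcomp (mollify ρ w x), hpair]
  simp only [hcurl, hcomp]
  simp only [cCurl, pd_mollify hρ hv.integrable, cross, cross_apply]
  fin_cases k <;> simp [integral_sub, hi]

/-! ### Approximate identities and the symmetry of the curl. -/

/-- A sequence of mollifiers supported in balls of radius tending to zero. -/
def bump (n : ℕ) : ContDiffBump (0 : R3) where
  rIn := 1 / (2 * (n + 1))
  rOut := 1 / (n + 1)
  rIn_pos := by positivity
  rIn_lt_rOut := by
    have : (0 : ℝ) < n + 1 := by positivity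
    exact one_div_lt_one_div_of_lt this (by linarith)

/-- The mollifier of unit mass built from `bump n`. -/
def mollifier (n : ℕ) : R3 → ℝ := (bump n).normed volume

theorem isSmoothCpt_mollifier (n : ℕ) : IsSmoothCpt (mollifier n) :=
  ⟨(bump n).contDiff_normed, (bump n).hasCompactSupport_normed⟩

/-- The radius 1 serves every `n`, so a single sliding distance works for all mollified fields. -/
theorem mollifier_eq_zero (n : ℕ) (x : R3) (hx : 1 < ‖x‖) : mollifier n x = 0 := by
  rw [← Function.notMem_support, mollifier, ContDiffBump.support_normed_eq]
  have : (bump n).rOut ≤ 1 := by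
    change 1 / ((n : ℝ) + 1) ≤ 1
    rw [div_le_one (by positivity)]
    linarith [(n.cast_nonneg : (0 : ℝ) ≤ n)]
  simp only [Metric.mem_ball, dist_zero_right, not_lt]
  linarith

theorem tendsto_integral_mollifier_mul {g : R3 → ℝ} (hg : Continuous g) :
    Tendsto (fun n => ∫ y, mollifier n y * g y) atTop (𝓝 (g 0)) := by
  have hr : Tendsto (fun n => (bump n).rOut) atTop (𝓝 0) :=
    tendsto_one_div_add_atTop_nhds_zero_nat
  -- The reflection of `g` cancels the one in the convolution evaluated at the origin.
  have h := ContDiffBump.convolution_tendsto_right_of_continuous (μ := volume) hr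
    (hg.comp continuous_neg) (0 : R3)
  simpa [convolution_lsmul, mollifier] using h

theorem tendsto_integral_inner_mollify {R : ℝ} {a b : R3 → R3} (ha : IsL2Ball R a)
    (hb : IsL2Ball R b) :
    Tendsto (fun n => ∫ x, ⟪mollify (mollifier n) a x, b x⟫) atTop (𝓝 (∫ x, ⟪a x, b x⟫)) := by
  have h := tendsto_integral_mollifier_mul (continuous_corr ha.memLp hb.memLp)
  rw [corr_zero] at h
  refine h.congr fun n => ?_
  have hm := isSmoothCpt_mollifier n
  have := integral_inner_mollify hm.1.continuous hm.2 ha.integrable hb.integrable 0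
  simpa using this.symm

/-- The curl is symmetric on fields of bounded support. -/
theorem HasGlobalCurl.symm {R : ℝ} {v w z q : R3 → R3} (hv : IsL2Ball R v) (hw : IsL2Ball R w)
    (hz : IsL2Ball R z) (hq : IsL2Ball R q) (h : HasGlobalCurl v w) (h' : HasGlobalCurl z q) :
    ∫ x, ⟪z x, w x⟫ = ∫ x, ⟪q x, v x⟫ := by
  -- The mollification of `z` is an admissible test field for `h`, and its curl is the mollification
  -- of `q`. The two approximating sequences therefore coincide.
  refine tendsto_nhds_unique (tendsto_integral_inner_mollify hz hw)
    ((tendsto_integral_inner_mollify hq hv).congr fun n => ?_)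
  have hm := isSmoothCpt_mollifier n
  have := h _ (isSmoothCpt_mollify hm hz)
  rw [h'.cCurl_mollify hm hz hq] at this
  simpa only [real_inner_comm] using this.symm

/-! ### The curl controls the helicity -/

theorem gradient_apply {χ : R3 → ℝ} {x : R3} (k : Fin 3) :
    gradient χ x k = fderiv ℝ χ x (EuclideanSpace.single k 1) := by
  have h : ⟪gradient χ x, EuclideanSpace.single k 1⟫ = fderiv ℝ χ x (EuclideanSpace.single k 1) := by
    simp [gradient]
  rw [← h, real_inner_comm, EuclideanSpace.inner_single_left]
  simp

theorem isSmoothCpt_gradient {χ : R3 → ℝ} (hχ : IsSmoothCpt χ) : IsSmoothCpt (gradient χ) := by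
  have hsm : ContDiff ℝ ∞ (fderiv ℝ χ) := hχ.1.fderiv_right (by simp)
  refine ⟨(InnerProductSpace.toDual ℝ R3).symm.contDiff.comp hsm, ?_⟩
  exact (hχ.2.fderiv ℝ).comp_left (g := (InnerProductSpace.toDual ℝ R3).symm) (by simp)

theorem cCurl_gradient {χ : R3 → ℝ} (hχ : ContDiff ℝ ∞ χ) (x : R3) : cCurl (gradient χ) x = 0 := by
  have hsm : ContDiff ℝ ∞ (fderiv ℝ χ) := hχ.fderiv_right (by simp)
  have hd : DifferentiableAt ℝ (fderiv ℝ χ) x := hsm.differentiable (by simp) x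
  have hg : DifferentiableAt ℝ (gradient χ) x :=
    ((InnerProductSpace.toDual ℝ R3).symm.contDiff.comp hsm).differentiable (n := ∞) (by simp) x
  have hpd : ∀ i k, pd (gradient χ) i k x = fderiv ℝ (fderiv ℝ χ) x (EuclideanSpace.single i 1)
      (EuclideanSpace.single k 1) := by
    intro i k
    have h1 := ((EuclideanSpace.proj k : R3 →L[ℝ] ℝ).hasFDerivAt.comp x hg.hasFDerivAt).fderiv
    have h2 := (hd.hasFDerivAt.clm_apply
      (hasFDerivAt_const (EuclideanSpace.single k (1 : ℝ) : R3) x)).fderiv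
    have h3 : (EuclideanSpace.proj k : R3 →L[ℝ] ℝ) ∘ gradient χ
        = fun y => fderiv ℝ χ y (EuclideanSpace.single k 1) :=
      funext fun y => gradient_apply k
    rw [h3, h2] at h1
    have h4 := congrArg (fun A : R3 →L[ℝ] ℝ => A (EuclideanSpace.single i 1)) h1
    simpa [pd] using h4.symm
  have hs : IsSymmSndFDerivAt ℝ χ x :=
    hχ.contDiffAt.isSymmSndFDerivAt (by
      rw [minSmoothness_of_isRCLikeNormedField]; exact WithTop.coe_le_coe.2 (le_top : (2 : ℕ∞) ≤ ⊤))
  have hsymm : ∀ i k, pd (gradient χ) i k x = pd (gradient χ) k i x := by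
    intro i k
    rw [hpd, hpd, hs]
  ext k
  fin_cases k <;> simp [cCurl, hsymm 1 2, hsymm 2 0, hsymm 0 1]

/-- A weak curl is weakly divergence free because curl grad = 0. -/
theorem HasGlobalCurl.integral_inner_gradient {v w : R3 → R3} (h : HasGlobalCurl v w) {χ : R3 → ℝ}
    (hχ : IsSmoothCpt χ) : ∫ x, ⟪w x, gradient χ x⟫ = 0 := by
  rw [h _ (isSmoothCpt_gradient hχ)]
  simp [cCurl_gradient hχ.1]

/-- The field `e₃ × w`. -/
def rotate (w : R3 → R3) (x : R3) : R3 := !₂[-w x 1, w x 0, 0]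

theorem norm_rotate_le (w : R3 → R3) (x : R3) : ‖rotate w x‖ ≤ ‖w x‖ := by
  rw [EuclideanSpace.norm_eq, EuclideanSpace.norm_eq]
  apply Real.sqrt_le_sqrt
  simp only [rotate, Fin.sum_univ_three, Real.norm_eq_abs, sq_abs]
  simp
  nlinarith [sq_nonneg (w x 2)]

theorem IsL2Ball.rotate {R : ℝ} {w : R3 → R3} (hw : IsL2Ball R w) :
    IsL2Ball R (MagnetoFriction.rotate w) := by
  refine ⟨hw.memLp.of_le ?_ (Eventually.of_forall (norm_rotate_le w)), fun x hx => ?_⟩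
  · have hc : Continuous fun y : R3 => (!₂[-y 1, y 0, 0] : R3) := by
      refine (PiLp.continuous_toLp 2 _).comp (continuous_pi fun i => ?_)
      fin_cases i <;> simp <;> fun_prop
    exact hc.comp_aestronglyMeasurable hw.memLp.1
  · ext i
    fin_cases i <;> simp [MagnetoFriction.rotate, hw.eq_zero x hx]

theorem norm_toLp_rotate_le {R : ℝ} {w : R3 → R3} (hw : IsL2Ball R w) :
    ‖hw.rotate.memLp.toLp (rotate w)‖ ≤ ‖hw.memLp.toLp w‖ := by
  refine Lp.norm_le_norm_of_ae_le ?_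
  filter_upwards [hw.memLp.coeFn_toLp, hw.rotate.memLp.coeFn_toLp] with x h1 h2
  rw [h1, h2]
  exact norm_rotate_le w x

theorem hasDerivAt_integral_inner_translate {φ : R3 → R3} (hφ : IsSmoothCpt φ) {w : R3 → R3}
    (hw : Integrable w) (e : R3) (s : ℝ) :
    HasDerivAt (fun s : ℝ => ∫ x, ⟪w x, φ (x + s • e)⟫)
      (∫ x, ⟪w x, fderiv ℝ φ (x + s • e) e⟫) s := by
  have h1 : ContDiff ℝ 1 φ := hφ.1.of_le (by simp)
  have hcd : Continuous (fderiv ℝ φ) := h1.continuous_fderiv one_ne_zero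
  obtain ⟨M, hM⟩ := hφ.2.exists_bound_of_continuous hφ.1.continuous
  obtain ⟨M', hM'⟩ := (hφ.2.fderiv ℝ).exists_bound_of_continuous hcd
  have hmeas : ∀ s : ℝ, AEStronglyMeasurable (fun x => ⟪w x, φ (x + s • e)⟫) volume := fun s =>
    hw.1.inner (hφ.1.continuous.comp (continuous_id.add continuous_const)).aestronglyMeasurable
  refine (hasDerivAt_integral_of_dominated_loc_of_deriv_le (bound := fun x => ‖w x‖ * (M' * ‖e‖))
    (F := fun (s : ℝ) x => ⟪w x, φ (x + s • e)⟫)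
    (F' := fun (s : ℝ) x => ⟪w x, fderiv ℝ φ (x + s • e) e⟫) univ_mem
    (Eventually.of_forall hmeas) ?_ ?_ ?_ (hw.norm.mul_const _) ?_).2
  · refine (hw.norm.mul_const M).mono' (hmeas s) (Eventually.of_forall fun x => ?_)
    exact (norm_inner_le_norm _ _).trans (by gcongr; exact hM _)
  · exact hw.1.inner ((hcd.comp (continuous_id.add continuous_const)).clm_apply
      continuous_const).aestronglyMeasurable
  · refine Eventually.of_forall fun x s _ => (norm_inner_le_norm _ _).trans ?_
    gcongr
    refine (ContinuousLinearMap.le_opNorm _ _).trans ?_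
    gcongr
    exact hM' _
  · refine Eventually.of_forall fun x s _ => ?_
    have hl : HasDerivAt (fun s : ℝ => x + s • e) e s := by
      simpa using ((hasDerivAt_id s).smul_const e).const_add x
    have hφd := ((h1.differentiable one_ne_zero) (x + s • e)).hasFDerivAt
    have := hφd.comp_hasDerivAt s hl
    exact (hasDerivAt_const s (w x)).inner ℝ this |>.congr_deriv (by simp)

/-- Pointwise `∂₃φ = ∇φ₃ + curl φ × e₃`. The gradient integrates to zero against `w`, and the triple
product moves `e₃` onto `w`, leaving a correlation of `w` with `e₃ × w` in which no derivative of
`v` other than its curl survives. -/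
theorem HasGlobalCurl.integral_inner_fderiv {R : ℝ} {v w : R3 → R3} (hv : IsL2Ball R v)
    (hw : IsL2Ball R w) (h : HasGlobalCurl v w) {ρ : R3 → ℝ} (hρ : IsSmoothCpt ρ) (z : R3) :
    ∫ x, ⟪w x, fderiv ℝ (mollify ρ v) (x + z) (EuclideanSpace.single 2 1)⟫
      = ∫ y, ρ y * corr w (rotate w) (y - z) := by
  set φ := mollify ρ v with hφdef
  have hφ : IsSmoothCpt φ := isSmoothCpt_mollify hρ hv
  set χ : R3 → ℝ := fun x => φ (x + z) 2 with hχdef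
  have hχ : IsSmoothCpt χ := by
    refine ⟨((EuclideanSpace.proj (2 : Fin 3) : R3 →L[ℝ] ℝ).contDiff.comp hφ.1).comp
      (contDiff_id.add contDiff_const), ?_⟩
    exact (hφ.2.comp_left (g := fun y : R3 => y 2) (by simp)).comp_homeomorph
      (Homeomorph.addRight z)
  have hχg : ∀ x k, gradient χ x k = pd φ k 2 (x + z) := by
    intro x k
    rw [gradient_apply]
    have h1 : HasFDerivAt (fun x => φ (x + z)) (fderiv ℝ φ (x + z)) x :=
      (hasFDerivAt_comp_add_right z).2 (hφ.1.differentiable (by simp) (x + z)).hasFDerivAt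
    have h2 := ((EuclideanSpace.proj (2 : Fin 3) : R3 →L[ℝ] ℝ).hasFDerivAt.comp x h1).fderiv
    have h3 : (EuclideanSpace.proj (2 : Fin 3) : R3 →L[ℝ] ℝ) ∘ (fun x => φ (x + z)) = χ := rfl
    rw [h3] at h2
    rw [h2]
    rfl
  have hpt : ∀ x, ⟪w x, fderiv ℝ φ (x + z) (EuclideanSpace.single 2 1)⟫
      = ⟪w x, gradient χ x⟫ + ⟪mollify ρ w (x + z), rotate w x⟫ := by
    intro x
    have hf : ∀ k, fderiv ℝ φ (x + z) (EuclideanSpace.single 2 1) k = pd φ 2 k (x + z) :=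
      fun k => rfl
    rw [← h.cCurl_mollify hρ hv hw, inner_eq_sum, inner_eq_sum, inner_eq_sum]
    simp only [hf, hχg, rotate, cCurl]
    simp
    ring
  have hi1 : Integrable fun x => ⟪w x, gradient χ x⟫ := by
    have hg := isSmoothCpt_gradient hχ
    obtain ⟨M, hM⟩ := hg.2.exists_bound_of_continuous hg.1.continuous
    refine (hw.integrable.norm.mul_const M).mono'
      (hw.integrable.1.inner hg.1.continuous.aestronglyMeasurable)
      (Eventually.of_forall fun x => (norm_inner_le_norm _ _).trans (by gcongr; exact hM _))
  have hi2 : Integrable fun x => ⟪mollify ρ w (x + z), rotate w x⟫ := by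
    have hg := isSmoothCpt_mollify hρ hw
    obtain ⟨M, hM⟩ := hg.2.exists_bound_of_continuous hg.1.continuous
    refine (hw.rotate.integrable.norm.const_mul M).mono'
      ((hg.1.continuous.comp (continuous_id.add continuous_const)).aestronglyMeasurable.inner
        hw.rotate.integrable.1)
      (Eventually.of_forall fun x => (norm_inner_le_norm _ _).trans (by gcongr; exact hM _))
  simp only [hpt]
  rw [integral_add hi1 hi2, h.integral_inner_gradient hχ, zero_add]
  have := integral_inner_mollify hρ.1.continuous hρ.2 hw.integrable hw.rotate.integrable (-z)
  simpa [sub_eq_add_neg] using this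

/-- Arnold's inequality for a field supported in a ball: its helicity is bounded by the energy of
its curl. -/
theorem HasGlobalCurl.abs_helicity_le {R : ℝ} (hR : 0 ≤ R) {v w : R3 → R3} (hv : IsL2Ball R v)
    (hw : IsL2Ball R w) (h : HasGlobalCurl v w) :
    |∫ x, ⟪v x, w x⟫| ≤ (2 * R + 2) * ‖hw.memLp.toLp w‖ ^ 2 := by
  have hlim := (tendsto_integral_inner_mollify hv hw).abs
  refine le_of_tendsto hlim (Eventually.of_forall fun n => ?_)
  have hm := isSmoothCpt_mollifier n
  set φ := mollify (mollifier n) v with hφdef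
  set e : R3 := EuclideanSpace.single 2 1 with he
  have hne : ‖e‖ = 1 := by simp [he]
  set f : ℝ → ℝ := fun s => ∫ x, ⟪w x, φ (x + s • e)⟫ with hf
  have hderiv := fun s => hasDerivAt_integral_inner_translate (isSmoothCpt_mollify hm hv)
    hw.integrable e s
  -- Cauchy–Schwarz bounds the correlation, and the mollifier has unit mass, so the slope bound
  -- depends on neither `n` nor `s`.
  have hbound : ∀ s : ℝ, ‖∫ x, ⟪w x, fderiv ℝ φ (x + s • e) e⟫‖ ≤ ‖hw.memLp.toLp w‖ ^ 2 := by
    intro s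
    rw [h.integral_inner_fderiv hv hw hm (s • e)]
    have hmass : ∫ y, mollifier n y = 1 := (bump n).integral_normed
    have hmi : Integrable (mollifier n) := hm.1.continuous.integrable_of_hasCompactSupport hm.2
    calc ‖∫ y, mollifier n y * corr w (rotate w) (y - s • e)‖
        ≤ ∫ y, mollifier n y * ‖hw.memLp.toLp w‖ ^ 2 := by
          refine norm_integral_le_of_norm_le (hmi.mul_const _) (Eventually.of_forall fun y => ?_)
          have h0 : 0 ≤ mollifier n y := (bump n).nonneg_normed y
          rw [norm_mul, Real.norm_of_nonneg h0]
          refine mul_le_mul_of_nonneg_left ?_ h0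
          refine (abs_corr_le hw.memLp hw.rotate.memLp _).trans ?_
          rw [pow_two]
          exact mul_le_mul_of_nonneg_left (norm_toLp_rotate_le hw) (norm_nonneg _)
      _ = ‖hw.memLp.toLp w‖ ^ 2 := by rw [integral_mul_const, hmass, one_mul]
  -- `φ` vanishes outside radius `R + 1` and `w` outside radius `R`; any shift longer than `2R + 1`
  -- separates them.
  have hend : f (2 * R + 2) = 0 := by
    refine integral_eq_zero_of_ae (Eventually.of_forall fun x => ?_)
    by_cases hx : R < ‖x‖
    · simp [hw.eq_zero x hx]
    · have h1 : ‖(2 * R + 2) • e‖ = 2 * R + 2 := by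
        rw [norm_smul, hne, mul_one, Real.norm_of_nonneg (by linarith)]
      have h2 : ‖(2 * R + 2) • e‖ ≤ ‖x + (2 * R + 2) • e‖ + ‖x‖ := by
        simpa using norm_sub_le (x + (2 * R + 2) • e) x
      have h3 : φ (x + (2 * R + 2) • e) = 0 :=
        mollify_eq_zero (mollifier_eq_zero n) hv.eq_zero (by linarith [not_lt.1 hx])
      simp [h3]
  have hmv := Convex.norm_image_sub_le_of_norm_hasDerivWithin_le (s := univ) (f := f)
    (fun s _ => (hderiv s).hasDerivWithinAt) (fun s _ => hbound s) convex_univ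
    (mem_univ (2 * R + 2)) (mem_univ 0)
  rw [hend] at hmv
  have hf0 : f 0 = ∫ x, ⟪φ x, w x⟫ := by simp [hf, real_inner_comm]
  rw [hf0] at hmv
  simp only [sub_zero, zero_sub, norm_neg, Real.norm_eq_abs] at hmv
  rw [abs_of_nonneg (by linarith : 0 ≤ 2 * R + 2)] at hmv
  linarith

/-! ### Extension by zero -/

/-- The extension by zero of a field on `Ω`. -/
def extend (Ω : Set R3) (v : L2V Ω) : R3 → R3 := Ω.indicator v

theorem isL2Ball_extend {Ω : Set R3} (hΩ : MeasurableSet Ω) {R : ℝ}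
    (hR : Ω ⊆ Metric.closedBall 0 R) (v : L2V Ω) : IsL2Ball R (extend Ω v) := by
  refine ⟨(memLp_indicator_iff_restrict hΩ).2 (Lp.memLp v), fun x hx => ?_⟩
  refine indicator_of_notMem (fun h => ?_) _
  have := hR h
  simp at this
  linarith

theorem integral_inner_extend {Ω : Set R3} (hΩ : MeasurableSet Ω) (v : L2V Ω) (φ : R3 → R3) :
    ∫ x, ⟪extend Ω v x, φ x⟫ = ∫ x in Ω, ⟪v x, φ x⟫ := by
  rw [← integral_indicator hΩ]
  congr 1
  funext x
  by_cases hx : x ∈ Ω <;> simp [extend, hx]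

theorem integral_inner_extend_extend {Ω : Set R3} (hΩ : MeasurableSet Ω) (v w : L2V Ω) :
    ∫ x, ⟪extend Ω v x, extend Ω w x⟫ = ⟪v, w⟫ := by
  rw [integral_inner_extend hΩ, L2.inner_def]
  refine setIntegral_congr_fun hΩ fun x hx => ?_
  simp [extend, hx]

theorem norm_toLp_extend {Ω : Set R3} (hΩ : MeasurableSet Ω) (v : L2V Ω)
    (h : MemLp (extend Ω v) 2 volume) : ‖h.toLp (extend Ω v)‖ = ‖v‖ := by
  rw [← sq_eq_sq₀ (norm_nonneg _) (norm_nonneg _), ← real_inner_self_eq_norm_sq,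
    ← real_inner_self_eq_norm_sq, ← integral_inner_extend_extend hΩ, L2.inner_def]
  refine integral_congr_ae ?_
  filter_upwards [h.coeFn_toLp] with x hx
  rw [hx]

theorem MemHCurl.hasWeakCurl_wCurl {Ω : Set R3} {v : L2V Ω} (h : MemHCurl Ω v) :
    HasWeakCurl Ω v (wCurl Ω v) := by
  rw [wCurl, dif_pos h]
  exact h.choose_spec

theorem MemHDiv.hasWeakDiv_wDiv {Ω : Set R3} {v : L2V Ω} (h : MemHDiv Ω v) :
    HasWeakDiv Ω v (wDiv Ω v) := by
  rw [wDiv, dif_pos h]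
  exact h.choose_spec

/-- The trace condition is Green's formula without boundary term for test fields that need not
vanish on the boundary of `Ω`, so the extension acquires no singular curl there. -/
theorem MemH0Curl.hasGlobalCurl {Ω : Set R3} (hΩ : MeasurableSet Ω) {v : L2V Ω}
    (h : MemH0Curl Ω v) : HasGlobalCurl (extend Ω v) (extend Ω (wCurl Ω v)) := by
  intro φ hφ
  rw [integral_inner_extend hΩ, integral_inner_extend hΩ]
  exact sub_eq_zero.1 (h.2 φ hφ)

/-- The curl is symmetric on `H₀(curl, Ω)`. -/
theorem MemH0Curl.inner_wCurl_comm {Ω : Set R3} (hΩ : MeasurableSet Ω)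
    (hb : Bornology.IsBounded Ω) {v z : L2V Ω} (hv : MemH0Curl Ω v) (hz : MemH0Curl Ω z) :
    ⟪z, wCurl Ω v⟫ = ⟪wCurl Ω z, v⟫ := by
  obtain ⟨R, hR⟩ := hb.subset_closedBall 0
  rw [← integral_inner_extend_extend hΩ, ← integral_inner_extend_extend hΩ]
  exact HasGlobalCurl.symm (isL2Ball_extend hΩ hR _) (isL2Ball_extend hΩ hR _)
    (isL2Ball_extend hΩ hR _) (isL2Ball_extend hΩ hR _) (hv.hasGlobalCurl hΩ) (hz.hasGlobalCurl hΩ)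

/-- Arnold's inequality on `H₀(curl, Ω)`. -/
theorem exists_arnold {Ω : Set R3} (hΩ : MeasurableSet Ω) (hb : Bornology.IsBounded Ω) :
    ∃ C : ℝ, 0 < C ∧ ∀ v : L2V Ω, MemH0Curl Ω v →
      C * |⟪v, wCurl Ω v⟫| ≤ ‖wCurl Ω v‖ ^ 2 := by
  obtain ⟨R', hR'⟩ := hb.subset_closedBall 0
  -- The radius obtained from boundedness need not be nonnegative.
  set R := max R' 0
  have hR : Ω ⊆ Metric.closedBall 0 R :=
    hR'.trans (Metric.closedBall_subset_closedBall (le_max_left _ _))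
  have hR0 : 0 ≤ R := le_max_right _ _
  refine ⟨(2 * R + 2)⁻¹, by positivity, fun v hv => ?_⟩
  have h := HasGlobalCurl.abs_helicity_le hR0 (isL2Ball_extend hΩ hR _)
    (isL2Ball_extend hΩ hR _) (hv.hasGlobalCurl hΩ)
  rw [integral_inner_extend_extend hΩ, norm_toLp_extend hΩ] at h
  rwa [inv_mul_le_iff₀ (by positivity)]

/-! ### Uniqueness and linearity of the weak derivatives -/

theorem IsSmoothCpt.cCurl {φ : R3 → R3} (hφ : IsSmoothCpt φ) :
    Continuous (cCurl φ) ∧ HasCompactSupport (MagnetoFriction.cCurl φ) := by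
  have h1 : ContDiff ℝ 1 φ := hφ.1.of_le (by simp)
  have hcd : Continuous (fderiv ℝ φ) := h1.continuous_fderiv one_ne_zero
  have hpd : ∀ i k, Continuous (pd φ i k) := fun i k =>
    (EuclideanSpace.proj k : R3 →L[ℝ] ℝ).continuous.comp (hcd.clm_apply continuous_const)
  refine ⟨(PiLp.continuous_toLp 2 _).comp (continuous_pi fun i => ?_), ?_⟩
  · fin_cases i <;> simp <;> fun_prop
  · refine (hφ.2.fderiv ℝ).mono fun x hx hx' => hx ?_
    ext i
    fin_cases i <;> simp [MagnetoFriction.cCurl, pd, hx']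

theorem memLp_restrict_of_hasCompactSupport {F : Type*} [NormedAddCommGroup F] {φ : R3 → F}
    (hc : Continuous φ) (hs : HasCompactSupport φ) (Ω : Set R3) :
    MemLp φ 2 (volume.restrict Ω) :=
  (hc.memLp_of_hasCompactSupport hs).restrict Ω

theorem integral_inner_eq {Ω : Set R3} {F : Type*} [NormedAddCommGroup F] [InnerProductSpace ℝ F]
    {φ : R3 → F} (hφ : MemLp φ 2 (volume.restrict Ω)) (v : Lp F 2 (volume.restrict Ω)) :
    ∫ x in Ω, ⟪v x, φ x⟫ = ⟪v, hφ.toLp φ⟫ := by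
  rw [L2.inner_def]
  refine integral_congr_ae ?_
  filter_upwards [hφ.coeFn_toLp] with x hx
  rw [hx]

/-- An `L²` function orthogonal to all test functions vanishes. -/
theorem eq_zero_of_forall_test {Ω : Set R3} (hΩ : IsOpen Ω) {F : Type*} [NormedAddCommGroup F]
    [InnerProductSpace ℝ F] [CompleteSpace F] (v : Lp F 2 (volume.restrict Ω))
    (h : ∀ φ : R3 → F, IsTest Ω φ → ∫ x in Ω, ⟪v x, φ x⟫ = 0) : v = 0 := by
  rw [Lp.eq_zero_iff_ae_eq_zero]
  have hloc : LocallyIntegrable v (volume.restrict Ω) :=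
    (Lp.memLp v).locallyIntegrable (by norm_num)
  refine (ae_restrict_iff' hΩ.measurableSet).2
    (hΩ.ae_eq_zero_of_integral_contDiff_smul_eq_zero ?_ ?_)
  · exact locallyIntegrableOn_of_locallyIntegrable_restrict hloc
  · intro g hg hgc hgs
    have h0 : ∀ x, x ∉ Ω → g x • v x = 0 := fun x hx => by
      rw [image_eq_zero_of_notMem_tsupport fun hx' => hx (hgs hx'), zero_smul]
    rw [← setIntegral_eq_integral_of_forall_compl_eq_zero h0]
    have hi : Integrable (fun x => g x • v x) (volume.restrict Ω) :=
      memLp_one_iff_integrable.1 ((Lp.memLp v).smul (p := 2) (q := 2) (r := 1)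
        (memLp_restrict_of_hasCompactSupport hg.continuous hgc Ω))
    -- Pairing with an arbitrary constant vector `c` turns the scalar test function `g` into the
    -- admissible test field `g c`.
    refine ext_inner_left ℝ fun c => ?_
    rw [← integral_inner hi c, inner_zero_right,
      ← h (fun x => g x • c) ⟨⟨hg.smul contDiff_const, hgc.smul_right⟩,
        (tsupport_smul_subset_left g _).trans hgs⟩]
    simp only [inner_smul_right, real_inner_comm]

/-- Uniqueness makes the arbitrarily chosen `wCurl` canonical, and therefore linear. -/
theorem HasWeakCurl.unique {Ω : Set R3} (hΩ : IsOpen Ω) {v w w' : L2V Ω}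
    (h : HasWeakCurl Ω v w) (h' : HasWeakCurl Ω v w') : w = w' := by
  rw [← sub_eq_zero]
  refine eq_zero_of_forall_test hΩ _ fun φ hφ => ?_
  have hφ2 := memLp_restrict_of_hasCompactSupport hφ.1.1.continuous hφ.1.2 Ω
  rw [integral_inner_eq hφ2, inner_sub_left, ← integral_inner_eq, ← integral_inner_eq, h φ hφ,
    h' φ hφ, sub_self]

theorem HasWeakDiv.unique {Ω : Set R3} (hΩ : IsOpen Ω) {v : L2V Ω} {d d' : L2S Ω}
    (h : HasWeakDiv Ω v d) (h' : HasWeakDiv Ω v d') : d = d' := by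
  rw [← sub_eq_zero]
  refine eq_zero_of_forall_test hΩ _ fun φ hφ => ?_
  have hφ2 := memLp_restrict_of_hasCompactSupport hφ.1.1.continuous hφ.1.2 Ω
  have e := h φ hφ
  rw [← h' φ hφ] at e
  rw [integral_inner_eq hφ2, inner_sub_left, ← integral_inner_eq, ← integral_inner_eq]
  simp only [RCLike.inner_apply, conj_trivial, mul_comm (φ _)]
  rw [e, sub_self]

theorem HasWeakCurl.add_smul {Ω : Set R3} {v w v' w' : L2V Ω} (h : HasWeakCurl Ω v w)
    (h' : HasWeakCurl Ω v' w') (c : ℝ) : HasWeakCurl Ω (v + c • v') (w + c • w') := by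
  intro φ hφ
  have hφ2 := memLp_restrict_of_hasCompactSupport hφ.1.1.continuous hφ.1.2 Ω
  have hcφ := hφ.1.cCurl
  have hφ3 := memLp_restrict_of_hasCompactSupport hcφ.1 hcφ.2 Ω
  rw [integral_inner_eq hφ2, integral_inner_eq hφ3]
  simp only [inner_add_left, inner_smul_left]
  rw [← integral_inner_eq, ← integral_inner_eq, ← integral_inner_eq, ← integral_inner_eq,
    h φ hφ, h' φ hφ]

theorem HasWeakDiv.add_smul {Ω : Set R3} {v v' : L2V Ω} {d d' : L2S Ω} (h : HasWeakDiv Ω v d)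
    (h' : HasWeakDiv Ω v' d') (c : ℝ) : HasWeakDiv Ω (v + c • v') (d + c • d') := by
  intro φ hφ
  have hφ2 := memLp_restrict_of_hasCompactSupport hφ.1.1.continuous hφ.1.2 Ω
  have hg := isSmoothCpt_gradient hφ.1
  have hφ3 := memLp_restrict_of_hasCompactSupport hg.1.continuous hg.2 Ω
  have key : ∀ d : L2S Ω, ∫ x in Ω, d x * φ x = ⟪d, hφ2.toLp φ⟫ := by
    intro d
    rw [← integral_inner_eq]
    simp [mul_comm]
  have e := h φ hφ
  have e' := h' φ hφ
  rw [key, integral_inner_eq hφ3] at e e' ⊢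
  simp only [inner_add_left, inner_smul_left, e, e']
  simp
  ring

/-- The weak curl as a linear map on a space of fields with a weak curl. -/
def curlₗ {Ω : Set R3} (hΩ : IsOpen Ω) (V : Submodule ℝ (L2V Ω)) (hV : ∀ v ∈ V, MemHCurl Ω v) :
    V →ₗ[ℝ] L2V Ω :=
  IsLinearMap.mk' (fun v => wCurl Ω v) (by
    have key : ∀ (v v' : V) (c : ℝ),
        wCurl Ω ((v : L2V Ω) + c • (v' : L2V Ω)) = wCurl Ω v + c • wCurl Ω v' := fun v v' c =>
      (hV _ (v + c • v').2).hasWeakCurl_wCurl.unique hΩ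
        ((hV _ v.2).hasWeakCurl_wCurl.add_smul (hV _ v'.2).hasWeakCurl_wCurl c)
    -- `key 0 0 1` says that the value at zero equals its own double.
    have h0 : wCurl Ω 0 = 0 := by simpa using key 0 0 1
    refine ⟨fun v v' => by simpa using key v v' 1, fun c v => ?_⟩
    simpa [h0] using key 0 v c)

/-- The weak divergence as a linear map on a space of fields with a weak divergence. -/
def divₗ {Ω : Set R3} (hΩ : IsOpen Ω) (V : Submodule ℝ (L2V Ω)) (hV : ∀ v ∈ V, MemHDiv Ω v) :
    V →ₗ[ℝ] L2S Ω :=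
  IsLinearMap.mk' (fun v => wDiv Ω v) (by
    have key : ∀ (v v' : V) (c : ℝ),
        wDiv Ω ((v : L2V Ω) + c • (v' : L2V Ω)) = wDiv Ω v + c • wDiv Ω v' := fun v v' c =>
      (hV _ (v + c • v').2).hasWeakDiv_wDiv.unique hΩ
        ((hV _ v.2).hasWeakDiv_wDiv.add_smul (hV _ v'.2).hasWeakDiv_wDiv c)
    have h0 : wDiv Ω 0 = 0 := by simpa using key 0 0 1
    refine ⟨fun v v' => by simpa using key v v' 1, fun c v => ?_⟩
    simpa [h0] using key 0 v c)

/-! ### Cross products -/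

theorem inner_cross_cross_left (a b : R3) : ⟪cross (cross a b) b, a⟫ = -‖cross a b‖ ^ 2 := by
  rw [← real_inner_self_eq_norm_sq, inner_eq_sum, inner_eq_sum]
  simp [cross, cross_apply]
  ring

theorem inner_cross_self (a b : R3) : ⟪cross a b, b⟫ = 0 := by
  rw [inner_eq_sum]
  simp [cross, cross_apply]
  ring

/-! ### The semi-discrete scheme -/

theorem eq_of_hasDerivWithinAt_zero {F : Type*} [NormedAddCommGroup F] [NormedSpace ℝ F]
    {f : ℝ → F} (hf : ∀ t, 0 ≤ t → HasDerivWithinAt f 0 (Ici 0) t) {t : ℝ} (ht : 0 ≤ t) :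
    f t = f 0 := by
  have := (convex_Ici (0 : ℝ)).norm_image_sub_le_of_norm_hasDerivWithin_le (f := f)
    (f' := fun _ => 0) (C := 0) (fun s hs => hf s hs) (fun s _ => by simp)
    (self_mem_Ici (a := (0 : ℝ))) (mem_Ici.2 ht)
  rw [zero_mul] at this
  exact sub_eq_zero.1 (norm_le_zero_iff.1 this)

namespace IsSolution

variable {Ω : Set R3} {X : DiscreteComplex Ω} {τ : ℝ} {B₀ : X.V2} {B : ℝ → X.V2}
  {E j H : ℝ → X.V1}

theorem timeDeriv_add_wCurl (h : IsSolution X τ B₀ B E j H) {t : ℝ} (ht : 0 ≤ t) :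
    (timeDeriv B t : L2V Ω) + wCurl Ω (E t) = 0 := by
  have hmem : (timeDeriv B t : L2V Ω) + wCurl Ω (E t) ∈ X.V2 :=
    X.V2.add_mem (timeDeriv B t).2 (X.curl_mem _ (E t).2)
  rw [← inner_self_eq_zero (𝕜 := ℝ), inner_add_left]
  exact h.advection t ht _ hmem

theorem coe_timeDeriv (h : IsSolution X τ B₀ B E j H) {t : ℝ} (ht : 0 ≤ t) :
    (timeDeriv B t : L2V Ω) = -wCurl Ω (E t) :=
  eq_neg_of_add_eq_zero_left (h.timeDeriv_add_wCurl ht)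

theorem hasDerivWithinAt_B (h : IsSolution X τ B₀ B E j H) {t : ℝ} (ht : 0 ≤ t) :
    HasDerivWithinAt B (timeDeriv B t) (Ici 0) t :=
  (h.contDiffOn_B.differentiableOn one_ne_zero t ht).hasDerivWithinAt

theorem hasDerivWithinAt_coe_B (h : IsSolution X τ B₀ B E j H) {t : ℝ} (ht : 0 ≤ t) :
    HasDerivWithinAt (fun s => (B s : L2V Ω)) (-wCurl Ω (E t)) (Ici 0) t := by
  rw [← h.coe_timeDeriv ht]
  exact X.V2.subtypeL.hasFDerivAt.comp_hasDerivWithinAt t (h.hasDerivWithinAt_B ht)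

/-- Finite dimensionality makes the divergence continuous on `X.V2`, so it commutes with the time
derivative, which is a discrete curl and hence divergence free. -/
theorem wDiv_eq (hΩ : IsOpen Ω) (hX : X.IsExact) (h : IsSolution X τ B₀ B E j H) {t : ℝ}
    (ht : 0 ≤ t) : wDiv Ω (B t) = wDiv Ω B₀ := by
  have := X.finite2
  set D := (divₗ hΩ X.V2 fun v hv => (X.mem2 v hv).1).toContinuousLinearMap
  have hD : ∀ v : X.V2, D v = wDiv Ω v := fun v => rfl
  rw [← h.initial, ← hD, ← hD]
  refine eq_of_hasDerivWithinAt_zero (f := fun s => D (B s)) (fun s hs => ?_) ht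
  have hd := D.hasFDerivAt.comp_hasDerivWithinAt s (h.hasDerivWithinAt_B hs)
  refine hd.congr_deriv ?_
  have hc : timeDeriv B s = -⟨wCurl Ω (E s), X.curl_mem _ (E s).2⟩ :=
    Subtype.ext (h.coe_timeDeriv hs)
  rw [hc, map_neg, hD, neg_eq_zero]
  exact (hX.exact2 _ (X.curl_mem _ (E s).2)).2 ⟨_, (E s).2, rfl⟩

/-- Take `E` as test field in the current equation and `j` in the electric one. -/
theorem inner_B_wCurl_E (h : IsSolution X τ B₀ B E j H) {t : ℝ} (ht : 0 ≤ t) :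
    ⟪(B t : L2V Ω), wCurl Ω (E t)⟫ = τ * crossNormSq (j t : L2V Ω) (H t) := by
  rw [← h.current t ht _ (E t).2, real_inner_comm]
  have := h.electric t ht _ (j t).2
  simp only [inner_cross_cross_left, integral_neg] at this
  rw [crossNormSq]
  linarith

/-- Take `E` as test field in the magnetic equation and `H` in the electric one, where the nonlinear
term is orthogonal to `H`. -/
theorem inner_B_E (h : IsSolution X τ B₀ B E j H) {t : ℝ} (ht : 0 ≤ t) :
    ⟪(B t : L2V Ω), (E t : L2V Ω)⟫ = 0 := by
  rw [← h.magnetic t ht _ (E t).2, real_inner_comm]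
  have := h.electric t ht _ (H t).2
  simpa only [inner_cross_self, integral_zero, mul_zero, add_zero] using this

/-- The dissipation equals `τ⁻¹ (j, E)`, whose continuity is immediate; no estimate of the products
is needed. -/
theorem continuousOn_crossNormSq (hτ : 0 < τ) (h : IsSolution X τ B₀ B E j H) :
    ContinuousOn (fun s => crossNormSq (j s : L2V Ω) (H s)) (Ici 0) := by
  have hc : ContinuousOn (fun s => τ⁻¹ * ⟪(j s : L2V Ω), (E s : L2V Ω)⟫) (Ici 0) :=
    continuousOn_const.mul (ContinuousOn.inner (𝕜 := ℝ)
      (continuous_subtype_val.comp_continuousOn h.continuousOn_j)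
      (continuous_subtype_val.comp_continuousOn h.continuousOn_E))
  refine hc.congr fun s hs => ?_
  have e := h.inner_B_wCurl_E (t := s) hs
  rw [← h.current s hs _ (E s).2] at e
  simp only [e]
  field_simp

theorem energy (hτ : 0 < τ) (h : IsSolution X τ B₀ B E j H) {t : ℝ} (ht : 0 ≤ t) :
    IntervalIntegrable (fun s => crossNormSq (j s : L2V Ω) (H s)) volume 0 t ∧
      ‖(B t : L2V Ω)‖ ^ 2 - ‖(B 0 : L2V Ω)‖ ^ 2
        = -2 * τ * ∫ s in (0 : ℝ)..t, crossNormSq (j s : L2V Ω) (H s) ∧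
      -2 * τ * ∫ s in (0 : ℝ)..t, crossNormSq (j s : L2V Ω) (H s) ≤ 0 := by
  have hint : IntervalIntegrable (fun s => crossNormSq (j s : L2V Ω) (H s)) volume 0 t := by
    refine ((h.continuousOn_crossNormSq hτ).mono ?_).intervalIntegrable
    rw [uIcc_of_le ht]
    exact Icc_subset_Ici_self
  refine ⟨hint, ?_, ?_⟩
  · have hd : ∀ s, 0 ≤ s → HasDerivWithinAt (fun s => ‖(B s : L2V Ω)‖ ^ 2)
        (-2 * τ * crossNormSq (j s : L2V Ω) (H s)) (Ici 0) s := by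
      intro s hs
      refine (h.hasDerivWithinAt_coe_B hs).norm_sq.congr_deriv ?_
      rw [inner_neg_right, h.inner_B_wCurl_E hs]
      ring
    rw [← intervalIntegral.integral_const_mul]
    symm
    refine intervalIntegral.integral_eq_sub_of_hasDeriv_right_of_le ht
      (fun s hs => ((hd s hs.1).continuousWithinAt).mono Icc_subset_Ici_self)
      (fun s hs => (hd s hs.1.le).mono fun x hx => hs.1.le.trans (le_of_lt hx))
      (hint.const_mul _)
  · have : 0 ≤ ∫ s in (0 : ℝ)..t, crossNormSq (j s : L2V Ω) (H s) :=
      intervalIntegral.integral_nonneg ht fun s _ => integral_nonneg fun x => by positivity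
    nlinarith

theorem exists_isPotential (hΩ : IsOpen Ω) (hX : X.IsExact) (h : IsSolution X τ B₀ B E j H)
    (h0 : wDiv Ω B₀ = 0) {t : ℝ} (ht : 0 ≤ t) : ∃ A, IsPotential X (B t : L2V Ω) A := by
  obtain ⟨A, hA, hAB⟩ := (hX.exact2 _ (B t).2).1 ((h.wDiv_eq hΩ hX ht).trans h0)
  exact ⟨A, hA, hAB⟩

end IsSolution

/-! ### Discrete potentials and conservation of helicity. -/

/-- Symmetry of the curl: `(A, curl A') = (curl A, A')`, and both curls are `b`. -/
theorem IsPotential.inner_eq {Ω : Set R3} (hΩ : IsOpen Ω) (hb : Bornology.IsBounded Ω)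
    {X : DiscreteComplex Ω} {b A A' : L2V Ω} (hA : IsPotential X b A) (hA' : IsPotential X b A') :
    ⟪A, b⟫ = ⟪A', b⟫ := by
  have h1 := (X.mem1 _ hA.1).inner_wCurl_comm hΩ.measurableSet hb (X.mem1 _ hA'.1)
  rw [hA.2, hA'.2] at h1
  rw [h1, real_inner_comm]

/-- A linear map between vector spaces has a linear generalized inverse. -/
theorem exists_generalized_inverse {K V W : Type*} [Field K] [AddCommGroup V] [Module K V]
    [AddCommGroup W] [Module K W] (c : V →ₗ[K] W) : ∃ G : W →ₗ[K] V, ∀ v, c (G (c v)) = c v := by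
  obtain ⟨g, hg⟩ := c.rangeRestrict.exists_rightInverse_of_surjective c.range_rangeRestrict
  obtain ⟨G, hG⟩ := g.exists_extend
  refine ⟨G, fun v => ?_⟩
  have h1 : G (c v) = g (c.rangeRestrict v) := LinearMap.congr_fun hG (c.rangeRestrict v)
  have h2 : c.rangeRestrict (g (c.rangeRestrict v)) = c.rangeRestrict v :=
    LinearMap.congr_fun hg (c.rangeRestrict v)
  rw [h1]
  exact congrArg Subtype.val h2

theorem hasDerivWithinAt_inner_zero {F : Type*} [NormedAddCommGroup F] [InnerProductSpace ℝ F]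
    {a b : ℝ → F} {a' b' : F} {s : Set ℝ} {t : ℝ} (ha : HasDerivWithinAt a a' s t)
    (hb : HasDerivWithinAt b b' s t) (h1 : ⟪a t, b'⟫ = 0) (h2 : ⟪a', b t⟫ = 0) :
    HasDerivWithinAt (fun s => ⟪a s, b s⟫) 0 s t :=
  (ha.inner ℝ hb).congr_deriv (by rw [h1, h2, add_zero])

/-- A linear choice of discrete potentials. -/
theorem DiscreteComplex.exists_potential_operator {Ω : Set R3} (hΩ : IsOpen Ω)
    (X : DiscreteComplex Ω) :
    ∃ G : X.V2 →L[ℝ] X.V1, ∀ v : X.V1, wCurl Ω (G ⟨wCurl Ω v, X.curl_mem _ v.2⟩) = wCurl Ω v := by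
  have := X.finite2
  set c : X.V1 →ₗ[ℝ] X.V2 := (curlₗ hΩ X.V1 fun v hv => (X.mem1 v hv).1).codRestrict X.V2
    fun v => X.curl_mem _ v.2
  obtain ⟨G, hG⟩ := exists_generalized_inverse c
  exact ⟨G.toContinuousLinearMap, fun v => congrArg Subtype.val (hG v)⟩

namespace IsSolution

variable {Ω : Set R3} {X : DiscreteComplex Ω} {τ : ℝ} {B₀ : X.V2} {B : ℝ → X.V2}
  {E j H : ℝ → X.V1}

/-- Arbitrary potentials may vary irregularly in time. Since helicity ignores the choice, they are
replaced by `G (B s)` with `G` linear and continuous, which is differentiable in `s`. -/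
theorem helicity_eq (hΩ : IsOpen Ω) (hb : Bornology.IsBounded Ω) (hX : X.IsExact)
    (h : IsSolution X τ B₀ B E j H) (h0 : wDiv Ω B₀ = 0) {t : ℝ} (ht : 0 ≤ t) {A A₀ : L2V Ω}
    (hA : IsPotential X (B t : L2V Ω) A) (hA₀ : IsPotential X (B 0 : L2V Ω) A₀) :
    ⟪A, (B t : L2V Ω)⟫ = ⟪A₀, (B 0 : L2V Ω)⟫ := by
  obtain ⟨G, hG⟩ := X.exists_potential_operator hΩ
  have hpot : ∀ s, 0 ≤ s → IsPotential X (B s : L2V Ω) (G (B s)) := by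
    intro s hs
    obtain ⟨a, ha, hab⟩ := h.exists_isPotential hΩ hX h0 hs
    refine ⟨(G (B s)).2, ?_⟩
    have hB : B s = ⟨wCurl Ω a, X.curl_mem _ ha⟩ := Subtype.ext hab.symm
    rw [hB]
    exact hG ⟨a, ha⟩
  rw [hA.inner_eq hΩ hb (hpot t ht), hA₀.inner_eq hΩ hb (hpot 0 le_rfl)]
  refine eq_of_hasDerivWithinAt_zero (f := fun s => ⟪(G (B s) : L2V Ω), (B s : L2V Ω)⟫)
    (fun s hs => ?_) ht
  have hdG : HasDerivWithinAt (fun s => (G (B s) : L2V Ω)) (G (timeDeriv B s) : L2V Ω) (Ici 0) s :=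
    (X.V1.subtypeL.comp G).hasFDerivAt.comp_hasDerivWithinAt s (h.hasDerivWithinAt_B hs)
  have hc : timeDeriv B s = -⟨wCurl Ω (E s), X.curl_mem _ (E s).2⟩ :=
    Subtype.ext (h.coe_timeDeriv hs)
  have hsym : ∀ v z : X.V1, ⟪(z : L2V Ω), wCurl Ω v⟫ = ⟪wCurl Ω z, (v : L2V Ω)⟫ := fun v z =>
    (X.mem1 _ v.2).inner_wCurl_comm hΩ.measurableSet hb (X.mem1 _ z.2)
  have hBE := h.inner_B_E hs
  have e1 : ⟪(G (B s) : L2V Ω), wCurl Ω (E s)⟫ = 0 := by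
    rw [hsym, (hpot s hs).2, hBE]
  -- `G (curl E)` may differ from `E`, but both have the same curl; writing `B` as a curl and using
  -- symmetry sees only that curl and reduces to `e1`.
  have e2 : ⟪(G ⟨wCurl Ω (E s), X.curl_mem _ (E s).2⟩ : L2V Ω), (B s : L2V Ω)⟫ = 0 := by
    rw [← (hpot s hs).2, hsym, hG, real_inner_comm, e1]
  refine hasDerivWithinAt_inner_zero hdG (h.hasDerivWithinAt_coe_B hs) ?_ ?_
  · rw [inner_neg_right, e1, neg_zero]
  · rw [hc, map_neg, Submodule.coe_neg, inner_neg_left, e2, neg_zero]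

end IsSolution

end MagnetoFriction

end

open MagnetoFriction in
theorem theorem3p1 (Ω : Set R3) (hΩ : IsBoundedLipschitzDomain Ω) (hc : ContractibleSpace Ω) :
    ∃ C : ℝ, 0 < C ∧
      ∀ (X : DiscreteComplex Ω), X.IsExact →
      ∀ (τ : ℝ), 0 < τ →
      ∀ (B₀ : X.V2) (B : ℝ → X.V2) (E j H : ℝ → X.V1), IsSolution X τ B₀ B E j H →
        -- magnetic advection equation
        (∀ t, 0 ≤ t → (timeDeriv B t : L2V Ω) + wCurl Ω (E t) = 0) ∧
        -- preservation of the divergence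
        (∀ t, 0 ≤ t → wDiv Ω (B t) = wDiv Ω B₀) ∧
        -- energy dissipation
        (∀ t, 0 ≤ t →
          IntervalIntegrable (fun s => crossNormSq (j s : L2V Ω) (H s)) MeasureTheory.volume 0 t ∧
          ‖(B t : L2V Ω)‖ ^ 2 - ‖(B 0 : L2V Ω)‖ ^ 2
            = -2 * τ * ∫ s in (0 : ℝ)..t, crossNormSq (j s : L2V Ω) (H s) ∧
          -2 * τ * ∫ s in (0 : ℝ)..t, crossNormSq (j s : L2V Ω) (H s) ≤ 0) ∧
        (wDiv Ω B₀ = 0 →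
          -- magnetic Gauss law
          (∀ t, 0 ≤ t → wDiv Ω (B t) = 0) ∧
          -- existence of a discrete potential, and independence of the helicity of its choice
          (∀ t, 0 ≤ t → (∃ A, IsPotential X (B t) A) ∧
            ∀ A A', IsPotential X (B t) A → IsPotential X (B t) A' →
              inner ℝ A (B t : L2V Ω) = inner ℝ A' (B t : L2V Ω)) ∧
          -- helicity conservation
          (∀ t, 0 ≤ t → ∀ A A₀, IsPotential X (B t) A → IsPotential X (B 0) A₀ →
            inner ℝ A (B t : L2V Ω) - inner ℝ A₀ (B 0 : L2V Ω) = 0) ∧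
          -- discrete Arnold inequality
          (∀ t, 0 ≤ t → ∀ A, IsPotential X (B t) A →
            C * |inner ℝ A (B t : L2V Ω)| ≤ ‖(B t : L2V Ω)‖ ^ 2)) := by
  obtain ⟨C, hC, harn⟩ := exists_arnold hΩ.isOpen.measurableSet hΩ.isBounded
  refine ⟨C, hC, fun X hX τ hτ B₀ B E j H h => ⟨fun t ht => h.timeDeriv_add_wCurl ht,
    fun t ht => h.wDiv_eq hΩ.isOpen hX ht, fun t ht => h.energy hτ ht, fun h0 =>
    ⟨fun t ht => (h.wDiv_eq hΩ.isOpen hX ht).trans h0, fun t ht =>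
      ⟨h.exists_isPotential hΩ.isOpen hX h0 ht, fun A A' hA hA' =>
        hA.inner_eq hΩ.isOpen hΩ.isBounded hA'⟩,
      fun t ht A A₀ hA hA₀ =>
        sub_eq_zero.2 (h.helicity_eq hΩ.isOpen hΩ.isBounded hX h0 ht hA hA₀),
      fun t ht A hA => ?_⟩⟩⟩
  have := harn A (X.mem1 A hA.1)
  rwa [hA.2] at this
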